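/- A system $(X,T)$ is a compact metric space $X$ with a homeomorphism $T:X\to X$; it is minimal if $X\neq\emptyset$ and every orbit $\{T^nx:n\in\mathbb Z\}$ is dense. A factor map (extension) $\pi:(X,T)\to(X',T')$ is a continuous surjection with $\pi\circ T=T'\circ\pi$; it is an almost one-to-one extension if $\{x\in X: |\pi^{-1}(\pi(x))|=1\}$ is residual in $X$. For minimal systems $(X,T)$ and $(Y,S)$, the maximal common equicontinuous factor $Eq(X,Y)$ is the equicontinuous system $(Z,R)$, unique up to isomorphism, with factor maps $\alpha:X\to Z$ and $\beta:Y\to Z$ such that for every equicontinuous system $(W,Q)$ and all factor maps $\phi:X\to W$, $\psi:Y\to W$ there are factor maps $\eta_1,\eta_2:Z\to W$ with $\phi=\eta_1\circ\alpha$ and $\psi=\eta_2\circ\beta$. It is a rotation $z\mapsto z+\theta$ of a compact metrizable abelian group; put $\gamma(x,y)=\alpha(x)-\beta(y)$ for $(x,y)\in X\times Y$ (different choices change $\gamma$ only by an isomorphism and a translation). We say that $X$ is strongly quasi-disjoint from $Y$, written $X\perp_{SQ}Y$, if there is a residual set $\Omega\subset Eq(X,Y)$ such that $\gamma^{-1}(z)$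 is a minimal subset of $(X\times Y,T\times S)$ for every $z\in\Omega$. Lemma. Let $(X,T)$, $(X',T')$ and $(Y,S)$ be minimal systems and let $\pi:(X,T)\to(X',T')$ be an almost one-to-one extension. If $X'\perp_{SQ}Y$, then $X\perp_{SQ}Y$. -/

import Mathlib

universe u

namespace TopDyn

/-- The two-sided orbit of `x` under a homeomorphism `T`. -/
def orbit {X : Type*} [TopologicalSpace X] (T : X ≃ₜ X) (x : X) : Set X :=
  Set.range fun n : ℤ => (T ^ n) x

/-- The system `(X, T)` is minimal: `X` is nonempty and every orbit is dense. -/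
def IsMinimalSystem {X : Type*} [TopologicalSpace X] (T : X ≃ₜ X) : Prop :=
  Nonempty X ∧ ∀ x : X, Dense (orbit T x)

/-- `M` is a minimal subset of `(X, T)`: nonempty, closed, invariant, and the orbit of each of its
points is dense in it. -/
def IsMinimalSubset {X : Type*} [TopologicalSpace X] (T : X ≃ₜ X) (M : Set X) : Prop :=
  M.Nonempty ∧ IsClosed M ∧ T '' M = M ∧ ∀ x ∈ M, M ⊆ closure (orbit T x)

/-- `π` is a factor map (homomorphism) from `(X, T)` onto `(Y, S)`. -/
def IsFactorMap {X Y : Type*} [TopologicalSpace X] [TopologicalSpace Y]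
    (T : X ≃ₜ X) (S : Y ≃ₜ Y) (π : X → Y) : Prop :=
  Continuous π ∧ Function.Surjective π ∧ ∀ x, π (T x) = S (π x)

/-- `π` is an almost one-to-one extension: a factor map whose set of points `x` with
`|π⁻¹(π x)| = 1` is residual. -/
def IsAlmostOneToOne {X Y : Type*} [TopologicalSpace X] [TopologicalSpace Y]
    (T : X ≃ₜ X) (S : Y ≃ₜ Y) (π : X → Y) : Prop :=
  IsFactorMap T S π ∧ {x : X | π ⁻¹' {π x} = {x}} ∈ residual X

/-- The system `(X, T)` is equicontinuous: the family of all `T ^ n`, `n ∈ ℤ`, is uniformly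
equicontinuous. -/
def IsEquicontinuousSystem {X : Type*} [MetricSpace X] (T : X ≃ₜ X) : Prop :=
  ∀ ε > 0, ∃ δ > 0, ∀ x y : X, dist x y < δ → ∀ n : ℤ, dist ((T ^ n) x) ((T ^ n) y) < ε

/-- `(Z, R)`, with the factor maps `α : X → Z` and `β : Y → Z`, is a maximal common equicontinuous
factor of `(X, T)` and `(Y, S)`: it is an equicontinuous common factor, and every equicontinuous
common factor `(W, Q)` of the two systems is a factor of it, compatibly with the factor maps. -/
structure IsMaxCommonEquicontinuousFactor {X Y Z : Type u}
    [TopologicalSpace X] [TopologicalSpace Y] [MetricSpace Z]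
    (T : X ≃ₜ X) (S : Y ≃ₜ Y) (R : Z ≃ₜ Z) (α : X → Z) (β : Y → Z) : Prop where
  equicontinuous : IsEquicontinuousSystem R
  left : IsFactorMap T R α
  right : IsFactorMap S R β
  maximal : ∀ (W : Type u) [MetricSpace W] [CompactSpace W] (Q : W ≃ₜ W),
    IsEquicontinuousSystem Q → ∀ (φ : X → W) (ψ : Y → W),
    IsFactorMap T Q φ → IsFactorMap S Q ψ →
    ∃ η₁ η₂ : Z → W, IsFactorMap R Q η₁ ∧ IsFactorMap R Q η₂ ∧ φ = η₁ ∘ α ∧ ψ = η₂ ∘ β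

/-- Strong quasi-disjointness of the minimal systems `(X, T)` and `(Y, S)`. The maximal common
equicontinuous factor of two minimal systems is presented as a rotation `z ↦ z + θ` of a compact
metrizable abelian group `Z`, with factor maps `α` and `β`; it is required that
`γ⁻¹(z)` is a minimal subset of `(X × Y, T × S)` for all `z` in a residual subset of `Z`, where
`γ (x, y) = α x - β y`. The presentation is unique up to isomorphism, and another choice of the
isomorphism, of the zero of `Z`, of `α` or of `β` changes `γ` only by a translation of `Z`. -/
def StronglyQuasiDisjoint {X Y : Type u} [TopologicalSpace X] [TopologicalSpace Y]
    (T : X ≃ₜ X) (S : Y ≃ₜ Y) : Prop :=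
  ∃ (Z : Type u) (_ : MetricSpace Z) (_ : CompactSpace Z) (_ : AddCommGroup Z)
    (_ : IsTopologicalAddGroup Z) (θ : Z) (α : X → Z) (β : Y → Z),
    IsMaxCommonEquicontinuousFactor T S (Homeomorph.addRight θ) α β ∧
    ∃ Ω ∈ residual Z, ∀ z ∈ Ω,
      IsMinimalSubset (T.prodCongr S) ((fun p : X × Y => α p.1 - β p.2) ⁻¹' {z})

end TopDyn

open Set Filter Topology

namespace TopDyn

/-! Some iterate carries a whole fibre of `π` close to a one-point fibre, so equicontinuous factors
cannot separate points of a fibre. Hence `Eq(X, Y) = Eq(X', Y)`, and `γ = γ' ∘ p` with `p = π × id`.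
One-point fibres of `p` are dense, so for open `U` the points whose entire `p`-fibre lies in `U`
form an open dense subset `V` of `U`. As `γ` is semi-open, only a nowhere dense set of `z` has
`γ⁻¹(z)` meeting `U` but not `V`. Discard these `z` for every `U` in a countable basis. In a
remaining fibre that meets `U`, minimality of `γ'⁻¹(z)` brings `p q` into `p '' V`, and hence `q`
into `U` (`exists_residual_isMinimalSubset_preimage`). -/

/-- A semiconjugacy of homeomorphisms intertwines all integer powers. -/
lemma map_zpow_apply {X Y : Type*} [TopologicalSpace X] [TopologicalSpace Y]
    {T : X ≃ₜ X} {S : Y ≃ₜ Y} {f : X → Y} (h : ∀ x, f (T x) = S (f x)) (n : ℤ) (x : X) :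
    f ((T ^ n) x) = (S ^ n) (f x) := by
  induction n generalizing x with
  | zero => rfl
  | succ n ih =>
    rw [zpow_add_one, zpow_add_one]
    change f ((T ^ (n : ℤ)) (T x)) = (S ^ (n : ℤ)) (S (f x))
    rw [ih, h]
  | pred n ih =>
    rw [zpow_sub_one, zpow_sub_one]
    change f ((T ^ (-(n : ℤ))) (T.symm x)) = (S ^ (-(n : ℤ))) (S.symm (f x))
    rw [ih]
    congr 1
    rw [← S.symm_apply_apply (f (T.symm x)), ← h, T.apply_symm_apply]

/-- Factor maps compose. -/
lemma IsFactorMap.comp {X Y Z : Type*} [TopologicalSpace X] [TopologicalSpace Y]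
    [TopologicalSpace Z] {T : X ≃ₜ X} {S : Y ≃ₜ Y} {R : Z ≃ₜ Z} {g : Y → Z} {f : X → Y}
    (hg : IsFactorMap S R g) (hf : IsFactorMap T S f) : IsFactorMap T R (g ∘ f) :=
  ⟨hg.1.comp hf.1, hg.2.1.comp hf.2.1, fun x => by simp [hf.2.2, hg.2.2]⟩

/-- A factor map of a compact minimal system is semi-open. -/
lemma IsFactorMap.nonempty_interior_image {X Z : Type*} [TopologicalSpace X] [CompactSpace X]
    [T2Space X] [TopologicalSpace Z] [CompactSpace Z] [T2Space Z] {T : X ≃ₜ X} {R : Z ≃ₜ Z}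
    {f : X → Z} (hf : IsFactorMap T R f) (hT : IsMinimalSystem T) {U : Set X} (hU : IsOpen U)
    (hne : U.Nonempty) : (interior (f '' U)).Nonempty := by
  obtain ⟨x₀, hx₀⟩ := hne
  obtain ⟨K, hK, hKc, hKU⟩ := exists_mem_nhds_isClosed_subset (hU.mem_nhds hx₀)
  have hclosed : IsClosed (f '' K) := (hKc.isCompact.image hf.1).isClosed
  have : Nonempty Z := ⟨f x₀⟩
  -- Every orbit visits `interior K`. Baire then applies to countably many closed translates of `f
  -- '' K`.
  have hcover : ⋃ n : ℤ, (R ^ n) ⁻¹' (f '' K) = univ := by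
    refine eq_univ_of_forall fun z => ?_
    obtain ⟨x, rfl⟩ := hf.2.1 z
    obtain ⟨_, hxK, n, rfl⟩ :=
      (hT.2 x).inter_open_nonempty _ isOpen_interior ⟨x₀, mem_interior_iff_mem_nhds.2 hK⟩
    exact mem_iUnion.2 ⟨n, _, interior_subset hxK, map_zpow_apply hf.2.2 n x⟩
  obtain ⟨n, z, hz⟩ := nonempty_interior_of_iUnion_of_closed
    (fun n : ℤ => hclosed.preimage (R ^ n).continuous) hcover
  rw [← (R ^ n).preimage_interior] at hz
  exact ⟨_, interior_mono (image_mono hKU) hz⟩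

/-- The points over which the whole fibre of a closed map lies in the open set `U`. -/
lemma isOpen_compl_image_compl {X Y : Type*} [TopologicalSpace X] [CompactSpace X]
    [TopologicalSpace Y] [T2Space Y] {p : X → Y} (hp : Continuous p) {U : Set X}
    (hU : IsOpen U) : IsOpen (p '' Uᶜ)ᶜ :=
  (hU.isClosed_compl.isCompact.image hp).isClosed.isOpen_compl

lemma mem_of_notMem_image_compl {X Y : Type*} {p : X → Y} {U : Set X} {x : X}
    (h : p x ∈ (p '' Uᶜ)ᶜ) : x ∈ U :=
  by_contra fun hx => h ⟨x, hx, rfl⟩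

/-- Points in one fibre of an almost one-to-one extension are identified by every equicontinuous
factor. -/
lemma IsAlmostOneToOne.eq_of_isEquicontinuousSystem {X X' W : Type*} [MetricSpace X]
    [CompactSpace X] [MetricSpace X'] [MetricSpace W] {T : X ≃ₜ X} {T' : X' ≃ₜ X'} {Q : W ≃ₜ W}
    {π : X → X'} (hπ : IsAlmostOneToOne T T' π) (hT' : IsMinimalSystem T')
    (hQ : IsEquicontinuousSystem Q) {φ : X → W} (hφ : IsFactorMap T Q φ) {x₁ x₂ : X}
    (h : π x₁ = π x₂) : φ x₁ = φ x₂ := by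
  by_contra hne
  obtain ⟨δ, hδ, hQδ⟩ := hQ _ (dist_pos.2 hne)
  have : Nonempty X := ⟨x₁⟩
  obtain ⟨x₀, hx₀⟩ := (dense_of_mem_residual hπ.2).nonempty
  set U := φ ⁻¹' Metric.ball (φ x₀) (δ / 2) with hUdef
  have hU : IsOpen U := Metric.isOpen_ball.preimage hφ.1
  -- The fibre over `π x₀` is `{x₀}`, so all fibres over points near `π x₀` lie in `U`.
  have hx₀U : π x₀ ∈ (π '' Uᶜ)ᶜ := by
    rintro ⟨x, hx, hxx⟩
    obtain rfl : x = x₀ := (hx₀ : π ⁻¹' {π x₀} = {x₀}).subset hxx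
    exact hx (Metric.mem_ball_self (half_pos hδ))
  obtain ⟨_, hn, n, rfl⟩ := (hT'.2 (π x₁)).inter_open_nonempty _
    (isOpen_compl_image_compl hπ.1.1 hU) ⟨_, hx₀U⟩
  have h₁ : (T ^ n) x₁ ∈ U := mem_of_notMem_image_compl (p := π)
    (by rw [map_zpow_apply hπ.1.2.2]; exact hn)
  have h₂ : (T ^ n) x₂ ∈ U := mem_of_notMem_image_compl (p := π)
    (by rw [map_zpow_apply hπ.1.2.2, ← h]; exact hn)
  have hlt : dist (φ ((T ^ n) x₁)) (φ ((T ^ n) x₂)) < δ := by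
    have := dist_triangle_right (φ ((T ^ n) x₁)) (φ ((T ^ n) x₂)) (φ x₀)
    have h₁' : dist (φ ((T ^ n) x₁)) (φ x₀) < δ / 2 := h₁
    have h₂' : dist (φ ((T ^ n) x₂)) (φ x₀) < δ / 2 := h₂
    linarith
  -- Going back by `-n` would put `φ x₁` and `φ x₂` closer than their own distance.
  have key := hQδ _ _ hlt (-n)
  have hinv : ∀ x, (T ^ (-n)) ((T ^ n) x) = x := fun x => by
    change (T ^ (-n) * T ^ n) x = x
    rw [← zpow_add, neg_add_cancel, zpow_zero]
    rfl
  rw [← map_zpow_apply hφ.2.2, ← map_zpow_apply hφ.2.2, hinv, hinv] at key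
  exact lt_irrefl _ key

/-- An equicontinuous factor of an almost one-to-one extension factors through the extension. -/
lemma IsAlmostOneToOne.exists_factor {X X' W : Type*} [MetricSpace X]
    [CompactSpace X] [MetricSpace X'] [MetricSpace W] {T : X ≃ₜ X} {T' : X' ≃ₜ X'} {Q : W ≃ₜ W}
    {π : X → X'} (hπ : IsAlmostOneToOne T T' π) (hT' : IsMinimalSystem T')
    (hQ : IsEquicontinuousSystem Q) {φ : X → W} (hφ : IsFactorMap T Q φ) :
    ∃ φ' : X' → W, IsFactorMap T' Q φ' ∧ φ = φ' ∘ π := by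
  obtain ⟨s, hs⟩ := hπ.1.2.1.hasRightInverse
  have hfac : ∀ x, φ (s (π x)) = φ x := fun x =>
    hπ.eq_of_isEquicontinuousSystem hT' hQ hφ (hs _)
  have hcomp : (φ ∘ s) ∘ π = φ := funext hfac
  refine ⟨φ ∘ s, ⟨?_, ?_, ?_⟩, hcomp.symm⟩
  · rw [(hπ.1.1.isClosedMap.isQuotientMap hπ.1.1 hπ.1.2.1).continuous_iff, hcomp]
    exact hφ.1
  · intro w
    obtain ⟨x, rfl⟩ := hφ.2.1 w
    exact ⟨π x, hfac x⟩
  · intro x'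
    obtain ⟨x, rfl⟩ := hπ.1.2.1 x'
    simp only [Function.comp_apply]
    rw [← hπ.1.2.2, hfac, hfac, hφ.2.2]

/-- Maximal common equicontinuous factors lift along almost one-to-one extensions. -/
lemma IsMaxCommonEquicontinuousFactor.comp_isAlmostOneToOne {X X' Y Z : Type u}
    [MetricSpace X] [CompactSpace X] [MetricSpace X'] [TopologicalSpace Y] [MetricSpace Z]
    {T : X ≃ₜ X} {T' : X' ≃ₜ X'} {S : Y ≃ₜ Y} {R : Z ≃ₜ Z} {α : X' → Z} {β : Y → Z} {π : X → X'}
    (h : IsMaxCommonEquicontinuousFactor T' S R α β) (hT' : IsMinimalSystem T')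
    (hπ : IsAlmostOneToOne T T' π) : IsMaxCommonEquicontinuousFactor T S R (α ∘ π) β where
  equicontinuous := h.equicontinuous
  left := h.left.comp hπ.1
  right := h.right
  maximal W _ _ Q hQ φ ψ hφ hψ := by
    obtain ⟨φ', hφ', rfl⟩ := hπ.exists_factor hT' hQ hφ
    obtain ⟨η₁, η₂, h₁, h₂, rfl, rfl⟩ := h.maximal W Q hQ φ' ψ hφ' hψ
    exact ⟨η₁, η₂, h₁, h₂, rfl, rfl⟩

/-- If `f` is continuous and semi-open and `V` is an open dense subset of `U`, then the set of
points whose fibre meets `U` but not `V` is nowhere dense. -/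
lemma isNowhereDense_image_diff_image {P Z : Type*} [TopologicalSpace P] [TopologicalSpace Z]
    {f : P → Z} (hf : Continuous f)
    (hsemi : ∀ V : Set P, IsOpen V → V.Nonempty → (interior (f '' V)).Nonempty) {U V : Set P}
    (hV : IsOpen V) (hUV : U ⊆ closure V) : IsNowhereDense (f '' U \ f '' V) := by
  have hVcl : f '' V ⊆ closure (interior (f '' V)) := by
    rintro _ ⟨v, hv, rfl⟩
    refine mem_closure_iff.2 fun O hO hvO => ?_
    -- Localising to `f ⁻¹' O` finds interior points of the image inside `O`.
    obtain ⟨z, hz⟩ := hsemi (V ∩ f ⁻¹' O) (hV.inter (hO.preimage hf)) ⟨v, hv, hvO⟩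
    obtain ⟨w, hw, rfl⟩ := interior_subset hz
    exact ⟨_, hw.2, interior_mono (image_mono inter_subset_left) hz⟩
  have hUcl : f '' U ⊆ closure (interior (f '' V)) :=
    calc f '' U ⊆ f '' closure V := image_mono hUV
      _ ⊆ closure (f '' V) := image_closure_subset_closure_image hf
      _ ⊆ _ := closure_minimal hVcl isClosed_closure
  have hfr : IsNowhereDense (frontier (interior (f '' V))) :=
    isClosed_frontier.isNowhereDense_iff.2
      (frontier_compl (interior (f '' V)) ▸ interior_frontier isOpen_interior.isClosed_compl)
  refine hfr.mono ?_
  rintro z ⟨hzU, hzV⟩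
  exact ⟨hUcl hzU, fun hz => hzV (interior_subset (interior_subset hz))⟩

/-- Let `γ'` be invariant, `p` an equivariant surjection which is irreducible in the sense that its
one-point fibres are dense, and `γ' ∘ p` semi-open. If residually many fibres of `γ'` are minimal,
then so are residually many fibres of `γ' ∘ p`. -/
lemma exists_residual_isMinimalSubset_preimage {P P' Z : Type*} [TopologicalSpace P]
    [CompactSpace P] [SecondCountableTopology P] [TopologicalSpace P'] [T2Space P']
    [TopologicalSpace Z] [T1Space Z] {F : P ≃ₜ P} {F' : P' ≃ₜ P'} {p : P → P'} {γ' : P' → Z}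
    (hp : IsFactorMap F F' p) (hdense : Dense {q | p ⁻¹' {p q} = {q}}) (hγ' : Continuous γ')
    (hinv : ∀ q, γ' (F' q) = γ' q)
    (hsemi : ∀ V : Set P, IsOpen V → V.Nonempty → (interior ((γ' ∘ p) '' V)).Nonempty)
    {Ω : Set Z} (hΩ : Ω ∈ residual Z) (hmin : ∀ z ∈ Ω, IsMinimalSubset F' (γ' ⁻¹' {z})) :
    ∃ Ω' ∈ residual Z, ∀ z ∈ Ω', IsMinimalSubset F ((γ' ∘ p) ⁻¹' {z}) := by
  set B := TopologicalSpace.countableBasis P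
  set γ := γ' ∘ p with hγdef
  have hγ : Continuous γ := hγ'.comp hp.1
  have hγinv : ∀ q, γ (F q) = γ q := fun q => by simp [γ, hp.2.2, hinv]
  let V : Set P → Set P := fun U => p ⁻¹' (p '' Uᶜ)ᶜ
  have hVo : ∀ U ∈ B, IsOpen (V U) := fun U hU =>
    (isOpen_compl_image_compl hp.1 (TopologicalSpace.isOpen_of_mem_countableBasis hU)).preimage hp.1
  have hUV : ∀ U ∈ B, U ⊆ closure (V U) := by
    intro U hU q hq
    refine mem_closure_iff.2 fun O hO hqO => ?_
    obtain ⟨r, ⟨hrO, hrU⟩, hr⟩ := hdense.inter_open_nonempty _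
      (hO.inter (TopologicalSpace.isOpen_of_mem_countableBasis hU)) ⟨q, hqO, hq⟩
    refine ⟨r, hrO, ?_⟩
    rintro ⟨s, hs, hsr⟩
    obtain rfl : s = r := (hr : p ⁻¹' {p r} = {r}).subset hsr
    exact hs hrU
  have hres : (⋂ U ∈ B, (γ '' U \ γ '' V U)ᶜ) ∈ residual Z :=
    (countable_bInter_mem (TopologicalSpace.countable_countableBasis P)).2 fun U hU =>
      (isNowhereDense_image_diff_image hγ hsemi (hVo U hU) (hUV U hU)).isMeagre
  refine ⟨_, inter_mem hΩ hres, fun z hz => ?_⟩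
  obtain ⟨⟨q₀, hq₀⟩, -, -, horb⟩ := hmin z hz.1
  refine ⟨?_, isClosed_singleton.preimage hγ, ?_, fun q hq w hw => ?_⟩
  · obtain ⟨r, rfl⟩ := hp.2.1 q₀
    exact ⟨r, hq₀⟩
  · ext q
    constructor
    · rintro ⟨r, hr, rfl⟩
      exact (hγinv r).trans hr
    · intro hq
      refine ⟨F.symm q, ?_, F.apply_symm_apply q⟩
      have := hγinv (F.symm q)
      rw [F.apply_symm_apply] at this
      exact this.symm.trans hq
  · refine (TopologicalSpace.isBasis_countableBasis P).mem_closure_iff.2 fun U hU hwU => ?_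
    -- The fibre over `z` meets `U` at `w`, and `z` is not exceptional for `U`.
    have hzU : z ∈ γ '' V U := by
      by_contra hzV
      exact mem_iInter₂.1 hz.2 U hU ⟨⟨w, hwU, hw⟩, hzV⟩
    obtain ⟨v, hv, hvz⟩ := hzU
    obtain ⟨_, hn, n, rfl⟩ := mem_closure_iff.1 (horb (p q) hq (show p v ∈ γ' ⁻¹' {z} from hvz)) _
      (isOpen_compl_image_compl hp.1 (TopologicalSpace.isOpen_of_mem_countableBasis hU)) hv
    refine ⟨(F ^ n) q, mem_of_notMem_image_compl (p := p) ?_, n, rfl⟩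
    rw [map_zpow_apply hp.2.2]
    exact hn

end TopDyn

open TopDyn in
theorem mainTheorem11 {X X' Y : Type u}
    [MetricSpace X] [CompactSpace X] [MetricSpace X'] [CompactSpace X']
    [MetricSpace Y] [CompactSpace Y]
    (T : X ≃ₜ X) (T' : X' ≃ₜ X') (S : Y ≃ₜ Y)
    (hT : TopDyn.IsMinimalSystem T) (hT' : TopDyn.IsMinimalSystem T')
    (hS : TopDyn.IsMinimalSystem S)
    (π : X → X') (hπ : TopDyn.IsAlmostOneToOne T T' π)
    (h : TopDyn.StronglyQuasiDisjoint T' S) :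
    TopDyn.StronglyQuasiDisjoint T S := by
  obtain ⟨Z, _, _, _, _, θ, α, β, hmax, Ω, hΩ, hmin⟩ := h
  have hmaxX := hmax.comp_isAlmostOneToOne hT' hπ
  refine ⟨Z, _, ‹_›, _, ‹_›, θ, α ∘ π, β, hmaxX, ?_⟩
  have hp : IsFactorMap (T.prodCongr S) (T'.prodCongr S) (Prod.map π id) :=
    ⟨hπ.1.1.prodMap continuous_id, hπ.1.2.1.prodMap Function.surjective_id, fun q =>
      Prod.ext (hπ.1.2.2 q.1) rfl⟩
  have hdense : Dense {q : X × Y | Prod.map π id ⁻¹' {Prod.map π id q} = {q}} := by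
    refine ((dense_of_mem_residual hπ.2).prod (dense_univ (X := Y))).mono ?_
    rintro ⟨x, y⟩ ⟨hx, -⟩
    refine Subset.antisymm ?_ (by rintro _ rfl; rfl)
    rintro ⟨x', y'⟩ hq
    obtain ⟨h₁, h₂⟩ := Prod.ext_iff.1 (mem_singleton_iff.1 hq)
    exact Prod.ext ((hx : π ⁻¹' {π x} = {x}).subset h₁) h₂
  refine exists_residual_isMinimalSubset_preimage (p := Prod.map π id)
    (γ' := fun q : X' × Y => α q.1 - β q.2) hp hdense ?_ ?_ ?_ hΩ hmin
  · exact (hmax.left.1.comp continuous_fst).sub (hmax.right.1.comp continuous_snd)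
  · intro q
    have h₁ : α (T' q.1) = α q.1 + θ := hmax.left.2.2 q.1
    have h₂ : β (S q.2) = β q.2 + θ := hmax.right.2.2 q.2
    change α (T' q.1) - β (S q.2) = _
    rw [h₁, h₂, add_sub_add_right_eq_sub]
  · rintro V hV ⟨⟨x, y⟩, hxy⟩
    -- One slice suffices: with `y` fixed, `γ` is the semi-open map `α ∘ π` followed by translation
    -- by `-β y`.
    have hslice : IsOpen {x' : X | (x', y) ∈ V} := hV.preimage (by fun_prop)
    obtain ⟨z, hz⟩ := hmaxX.left.nonempty_interior_image hT hslice ⟨x, hxy⟩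
    refine ⟨z - β y, interior_maximal ?_
      ((Homeomorph.subRight (β y)).isOpenMap _ isOpen_interior) ⟨z, hz, rfl⟩⟩
    rintro _ ⟨w, hw, rfl⟩
    obtain ⟨x', hx', rfl⟩ := interior_subset hw
    exact ⟨(x', y), hx', rfl⟩
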